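/- **Conventions.** Languages are algebraic and have no nullary operation symbols; algebras are non-empty; "family" means set-indexed family. A *logic* $\vdash$ is a substitution-invariant consequence relation on the set $Fm(\vdash)$ of formulas of a language $\mathscr{L}_\vdash$ in the variables $\{x_\alpha : \alpha<\kappa_\vdash\}$, where $\kappa_\vdash$ is an infinite cardinal. A *matrix* is a pair $\langle A,F\rangle$ with $A$ an algebra and $F\subseteq A$. It is a *model* of $\vdash$ if $F$ is a deductive filter of $\vdash$ on $A$, i.e. $\Gamma\vdash\varphi$ and $h[\Gamma]\subseteq F$ imply $h(\varphi)\in F$ for every homomorphism $h$ from the formula algebra to $A$; $\mathsf{Mod}(\vdash)$ is the class of models. The Leibniz congruence $\Omega^AF$ is the largest congruence of $A$ compatible with $F$ (i.e. not relating elements of $F$ to elements outside $F$), and $\mathsf{R}(\mathsf{K})$ is the class of isomorphic copies of the matrices $\langle A/\Omega^AF, F/\Omega^AF\rangle$ with $\langle A,F\rangle\in\mathsf{K}$. The Suszko congruence of $\langle A,F\rangle$ with respect to $\vdash$ is $\bigcap\{\Omega^AG : G\supseteq F \text{ a deductive filter of } \vdash \text{ on } A\}$, and $\mathsf{Mod}^{\equiv}(\vdash)$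 is the class of models of $\vdash$ whose Suszko congruence is the identity. $\mathsf{P}_{\mathrm{sd}}(\mathsf{K})$ is the class of isomorphic copies of submatrices $\langle A,F\rangle$ of products $\prod_{j\in J}\langle A_j,F_j\rangle$ of members of $\mathsf{K}$ (with $J$ a set, possibly empty, the empty product being the trivial matrix $\langle \mathbf 1,\{1\}\rangle$) all of whose projections $A\to A_j$ are surjective; here a submatrix of $\langle B,G\rangle$ is a matrix $\langle A,G\cap A\rangle$ with $A$ a subalgebra of $B$. For languages $\mathscr{L}_i$ $(i\in I)$, with $I\neq\emptyset$, the $n$-ary symbols of $\bigotimes_{i}\mathscr{L}_i$ are the families $\langle\varphi_i(x_1,\dots,x_n):i\in I\rangle$ with $\varphi_i$ an $\mathscr{L}_i$-formula in the variables $x_1,\dots,x_n$; for $I=\emptyset$ this language is empty. The *non-indexed product* $\bigotimes_i\langle A_i,F_i\rangle$ of $\mathscr{L}_i$-matrices has universe $\prod_iA_i$, designated set $\prod_iF_i$, and each symbol $\langle\varphi_i:i\in I\rangle$ acts as $\varphi_i^{A_i}$ in coordinate $i$. $\bigotimes_i\mathsf{K}_i$ is the class of isomorphic copies of the matrices $\bigotimes_i\langle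 A_i,F_i\rangle$ with $\langle A_i,F_i\rangle\in\mathsf{K}_i$. We write $\langle A,F\rangle\leq_{\mathrm{sd}}\bigotimes_i\langle A_i,F_i\rangle$ if $\langle A,F\rangle$ is isomorphic to a submatrix of $\bigotimes_i\langle A_i,F_i\rangle$ all of whose projections to the $A_i$ are surjective. The *non-indexed product* $\bigotimes_i{\vdash_i}$ of logics is the logic in the language $\bigotimes_i\mathscr{L}_{\vdash_i}$ in $\kappa=\prod_i|Fm(\vdash_i)|$ variables ($\kappa=\aleph_0$ if $I=\emptyset$) induced by the class of matrices $\bigotimes_i\mathsf{Mod}^{\equiv}(\vdash_i)$, i.e. $\Gamma$ entails $\varphi$ iff for every matrix $\langle A,F\rangle$ of the class and every homomorphism $h$ from the formula algebra to $A$, $h[\Gamma]\subseteq F$ implies $h(\varphi)\in F$. The product $\vdash\bigotimes\vdash'$ and the class $\mathsf{K}\bigotimes\mathsf{K}'$ are the case of a two-element index set. **Proposition.** If $\{\vdash_i : i\in I\}$ is a family of logics, then $$\mathsf{Mod}^{\equiv}\Big(\bigotimes_{i\in I}{\vdash_i}\Big)=\mathsf{P}_{\mathrm{sd}}\Big(\bigotimes_{i\in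 I}\mathsf{R}(\mathsf{Mod}(\vdash_i))\Big)=\mathsf{P}_{\mathrm{sd}}\Big(\bigotimes_{i\in I}\mathsf{Mod}^{\equiv}(\vdash_i)\Big).$$ Moreover, $$\mathsf{Mod}^{\equiv}\Big(\bigotimes_{i\in I}{\vdash_i}\Big)=\Big\{\langle A,F\rangle : \langle A,F\rangle\leq_{\mathrm{sd}}\bigotimes_{i\in I}\langle A_i,F_i\rangle\text{ for some }\langle A_i,F_i\rangle\in\mathsf{Mod}^{\equiv}(\vdash_i)\Big\}.$$ Finally, if $\vdash$ and $\vdash'$ are logics, then $\mathsf{Mod}^{\equiv}(\vdash\bigotimes\vdash')=\mathsf{Mod}^{\equiv}(\vdash)\bigotimes\mathsf{Mod}^{\equiv}(\vdash')$. -/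

import Mathlib

universe u

namespace AAL

open FirstOrder FirstOrder.Language Cardinal

noncomputable section

/-! ## Matrices

Algebraic languages are first-order languages without relation symbols. -/

/-- A matrix `⟨A, F⟩` in the language `L`: a (non-empty) algebra `A` with a subset `F ⊆ A`. -/
structure LMatrix (L : FirstOrder.Language.{u, u}) where
  carrier : Type u
  [nonempty : Nonempty carrier]
  [str : L.Structure carrier]
  filter : Set carrier

attribute [instance] LMatrix.nonempty LMatrix.str

namespace LMatrix

variable {L : FirstOrder.Language.{u, u}}

/-- The matrix `⟨A, G⟩`, with the same algebra as `M = ⟨A, F⟩`. -/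
abbrev withFilter (M : LMatrix L) (G : Set M.carrier) : LMatrix L :=
  { carrier := M.carrier, filter := G }

/-- `M` and `N` are isomorphic: there is an isomorphism of the algebras that preserves and reflects
membership in the designated sets. -/
def Iso (M N : LMatrix L) : Prop :=
  ∃ e : M.carrier ≃[L] N.carrier, ∀ a, a ∈ M.filter ↔ e a ∈ N.filter

/-- `e` is an embedding of matrices, that is, an isomorphism of `M` onto a submatrix of `N`
(a submatrix of `⟨B, G⟩` is a matrix `⟨A, G ∩ A⟩` with `A` a subalgebra of `B`). -/
def IsMatrixEmbedding {M N : LMatrix L} (e : M.carrier ↪[L] N.carrier) : Prop :=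
  ∀ a, a ∈ M.filter ↔ e a ∈ N.filter

/-- The direct product of a family of matrices in the same language. For an empty family it is the
trivial matrix. -/
def prod {J : Type u} (N : J → LMatrix L) : LMatrix L where
  carrier := ∀ j, (N j).carrier
  str :=
    { funMap := fun f x j => Structure.funMap f (fun k => x k j)
      RelMap := fun r x => ∀ j, Structure.RelMap r (fun k => x k j) }
  filter := {a | ∀ j, a j ∈ (N j).filter}

/-- `θ` is a congruence of the algebra reduct of `M`. -/
def IsCongruence (M : LMatrix L) (θ : Setoid M.carrier) : Prop :=
  ∀ (n : ℕ) (f : L.Functions n) (x y : Fin n → M.carrier),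
    (∀ k, θ (x k) (y k)) → θ (Structure.funMap f x) (Structure.funMap f y)

/-- `θ` is compatible with the designated set `F` of `M`. -/
def IsCompatible (M : LMatrix L) (θ : Setoid M.carrier) : Prop :=
  ∀ a b, θ a b → a ∈ M.filter → b ∈ M.filter

/-- The Leibniz congruence `Ω^A F` of `M = ⟨A, F⟩`: the largest congruence of `A` compatible
with `F` (see `isGreatest_leibniz`). -/
def leibniz (M : LMatrix L) : Setoid M.carrier :=
  sSup {θ | M.IsCongruence θ ∧ M.IsCompatible θ}

theorem isCongruence_leibniz (M : LMatrix L) : M.IsCongruence M.leibniz := by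
  classical
  intro n f x y hxy
  have step : ∀ (k : Fin n) (z : Fin n → M.carrier) (a b : M.carrier), M.leibniz a b →
      M.leibniz (Structure.funMap f (Function.update z k a))
        (Structure.funMap f (Function.update z k b)) := by
    intro k z a b hab
    have key : M.leibniz ≤ Setoid.comap
        (fun c => Structure.funMap f (Function.update z k c)) M.leibniz := by
      refine sSup_le ?_
      intro θ hθ a b hab
      have hle : θ ≤ M.leibniz := le_sSup hθ
      refine hle (hθ.1 n f _ _ fun i => ?_)
      by_cases h : i = k
      · subst h
        simpa only [Function.update_self] using hab
      · simpa [Function.update_of_ne h] using θ.refl (z i)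
    exact key hab
  have main : ∀ s : Finset (Fin n), M.leibniz (Structure.funMap f x)
      (Structure.funMap f (fun i => if i ∈ s then y i else x i)) := by
    intro s
    induction s using Finset.induction_on with
    | empty => exact M.leibniz.refl (Structure.funMap f x)
    | insert k s hk ih =>
      refine M.leibniz.trans ih ?_
      have h := step k (fun i => if i ∈ s then y i else x i) (x k) (y k) (hxy k)
      convert h using 2
      · funext i
        by_cases hi : i = k
        · subst hi; simp [hk]
        · simp [Function.update_of_ne hi]
      · funext i
        by_cases hi : i = k
        · subst hi; simp
        · simp [hi]
  simpa using main Finset.univ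

theorem isCompatible_leibniz (M : LMatrix L) : M.IsCompatible M.leibniz := by
  have key : M.leibniz ≤ Setoid.ker (fun a => a ∈ M.filter) := by
    refine sSup_le ?_
    intro θ hθ a b hab
    exact propext ⟨hθ.2 a b hab, hθ.2 b a (θ.symm hab)⟩
  intro a b hab ha
  have h : (a ∈ M.filter) = (b ∈ M.filter) := key hab
  exact h ▸ ha

theorem isGreatest_leibniz (M : LMatrix L) :
    IsGreatest {θ | M.IsCongruence θ ∧ M.IsCompatible θ} M.leibniz :=
  ⟨⟨M.isCongruence_leibniz, M.isCompatible_leibniz⟩, fun _ h => le_sSup h⟩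

/-- The quotient matrix `⟨A, F⟩* = ⟨A / Ω^A F, F / Ω^A F⟩`. -/
def reduction [L.IsAlgebraic] (M : LMatrix L) : LMatrix L :=
  letI : L.Prestructure M.leibniz :=
    { toStructure := M.str
      fun_equiv := fun {n} {f} x y h => M.isCongruence_leibniz n f x y h
      rel_equiv := fun {_} {r} => isEmptyElim r }
  { carrier := Quotient M.leibniz
    nonempty := M.nonempty.map (Quotient.mk M.leibniz)
    str := inferInstance
    filter := Quotient.mk M.leibniz '' M.filter }

end LMatrix

/-! ## Class operators -/

section ClassOperators

variable {L : FirstOrder.Language.{u, u}}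

/-- The closure `I(K)` of a class of matrices under isomorphic copies. -/
def isoClosure (K : Set (LMatrix L)) : Set (LMatrix L) :=
  {M | ∃ N ∈ K, M.Iso N}

/-- The class `R(K)` of isomorphic copies of the matrices `⟨A, F⟩*` with `⟨A, F⟩ ∈ K`. -/
def reducedClass [L.IsAlgebraic] (K : Set (LMatrix L)) : Set (LMatrix L) :=
  isoClosure (LMatrix.reduction '' K)

/-- The class `P_sd(K)` of (isomorphic copies of) subdirect products of set-indexed, possibly empty
families of members of `K`: the matrices with an embedding into a product of members of `K` whose
composition with every projection is surjective. -/
def subdirectProducts (K : Set (LMatrix L)) : Set (LMatrix L) :=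
  {M | ∃ (J : Type u) (N : J → LMatrix L), (∀ j, N j ∈ K) ∧
    ∃ e : M.carrier ↪[L] (LMatrix.prod N).carrier, LMatrix.IsMatrixEmbedding e ∧
      ∀ j, Function.Surjective (fun a : M.carrier => (e a : ∀ j, (N j).carrier) j)}

end ClassOperators

/-! ## Logics -/

/-- A logic: a substitution-invariant consequence relation on the set `Fm_L(κ)` of formulas of an
algebraic language `L` without nullary symbols in the variables `x_α`, `α < κ`, where `κ` is an
infinite cardinal. -/
structure PropLogic where
  lang : FirstOrder.Language.{u, u}
  [algebraic : lang.IsAlgebraic]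
  noConst : IsEmpty (lang.Functions 0)
  card : Cardinal.{u}
  aleph0_le_card : ℵ₀ ≤ card
  Entails : Set (lang.Term card.ord.ToType) → lang.Term card.ord.ToType → Prop
  refl : ∀ Γ φ, φ ∈ Γ → Entails Γ φ
  mono : ∀ Γ Δ φ, Γ ⊆ Δ → Entails Γ φ → Entails Δ φ
  cut : ∀ Γ Δ φ, (∀ ψ ∈ Δ, Entails Γ ψ) → Entails Δ φ → Entails Γ φ
  subst : ∀ (σ : card.ord.ToType → lang.Term card.ord.ToType) (Γ) (φ),
    Entails Γ φ → Entails ((fun ψ => ψ.subst σ) '' Γ) (φ.subst σ)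

attribute [instance] PropLogic.algebraic

namespace PropLogic

/-- The set of variables of a logic. -/
abbrev Var (P : PropLogic.{u}) : Type u := P.card.ord.ToType

/-- The set `Fm(⊢)` of formulas of a logic. -/
abbrev Fm (P : PropLogic.{u}) : Type u := P.lang.Term P.Var

/-- `M = ⟨A, F⟩` is a model of `P`, that is, `F` is a deductive filter of `P` on `A`.
Homomorphisms from the formula algebra to `A` are given by the assignments `v` of elements of `A`
to the variables, through `φ ↦ φ.realize v`. -/
def IsModel (P : PropLogic.{u}) (M : LMatrix P.lang) : Prop :=
  ∀ (Γ : Set P.Fm) (φ : P.Fm), P.Entails Γ φ → ∀ v : P.Var → M.carrier,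
    (∀ γ ∈ Γ, γ.realize v ∈ M.filter) → φ.realize v ∈ M.filter

/-- The class `Mod(⊢)` of models of a logic. -/
def models (P : PropLogic.{u}) : Set (LMatrix P.lang) :=
  {M | P.IsModel M}

/-- The Suszko congruence of `M = ⟨A, F⟩`: the intersection of the Leibniz congruences `Ω^A G`,
where `G` ranges over the deductive filters of the logic on `A` with `F ⊆ G`. -/
def suszko (P : PropLogic.{u}) (M : LMatrix P.lang) : Setoid M.carrier :=
  sInf {θ | ∃ G : Set M.carrier, P.IsModel (M.withFilter G) ∧ M.filter ⊆ G ∧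
    θ = (M.withFilter G).leibniz}

/-- The class `Mod^≡(⊢)` of Suszko-reduced models: the models whose Suszko congruence is the
identity relation. -/
def suszkoModels (P : PropLogic.{u}) : Set (LMatrix P.lang) :=
  {M | M ∈ P.models ∧ P.suszko M = ⊥}

/-- The logic in `κ` variables induced by a class of matrices. -/
def induced (L : FirstOrder.Language.{u, u}) [L.IsAlgebraic] (hL : IsEmpty (L.Functions 0))
    (κ : Cardinal.{u}) (hκ : ℵ₀ ≤ κ) (K : Set (LMatrix L)) : PropLogic.{u} where
  lang := L
  noConst := hL
  card := κ
  aleph0_le_card := hκ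
  Entails Γ φ := ∀ M ∈ K, ∀ v : κ.ord.ToType → M.carrier,
    (∀ γ ∈ Γ, γ.realize v ∈ M.filter) → φ.realize v ∈ M.filter
  refl := fun _ φ hφ _ _ _ h => h φ hφ
  mono := fun _ _ _ hΓ h M hM v hv => h M hM v fun γ hγ => hv γ (hΓ hγ)
  cut := fun _ _ _ h h' M hM v hv => h' M hM v fun ψ hψ => h ψ hψ M hM v hv
  subst := fun σ Γ φ h M hM v hv => by
    rw [Term.realize_subst]
    refine h M hM _ fun γ hγ => ?_
    rw [← Term.realize_subst]
    exact hv _ ⟨γ, hγ, rfl⟩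

end PropLogic

/-! ## Non-indexed products -/

section NonIndexed

variable {I : Type u}

/-- The language `⨂ᵢ Lᵢ`: its `n`-ary symbols are the families `⟨φᵢ(x₁, …, xₙ) : i ∈ I⟩` with `φᵢ` a
formula of `Lᵢ` in the variables `x₁, …, xₙ`. For `I = ∅` it is stipulated to be the empty
language. -/
def tensorLang (L : I → FirstOrder.Language.{u, u}) : FirstOrder.Language.{u, u} where
  Functions n := {_φ : ∀ i, (L i).Term (Fin n) // Nonempty I}
  Relations _ := PEmpty

instance tensorLang_isAlgebraic (L : I → FirstOrder.Language.{u, u}) : (tensorLang L).IsAlgebraic :=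
  fun _ => inferInstanceAs (IsEmpty PEmpty)

theorem isEmpty_term_of_noConst {L : FirstOrder.Language.{u, u}} (h : IsEmpty (L.Functions 0)) :
    IsEmpty (L.Term (Fin 0)) := by
  refine ⟨fun t => ?_⟩
  induction t with
  | var k => exact k.elim0
  | @func n f _ ih =>
    cases n with
    | zero => exact h.false f
    | succ n => exact ih 0

theorem tensorLang_noConst {L : I → FirstOrder.Language.{u, u}} (h : ∀ i, IsEmpty ((L i).Functions 0)) :
    IsEmpty ((tensorLang L).Functions 0) := by
  refine ⟨fun φ => ?_⟩
  obtain ⟨i⟩ := φ.2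
  exact (isEmpty_term_of_noConst (h i)).false (φ.1 i)

/-- The non-indexed product `⨂ᵢ ⟨Aᵢ, Fᵢ⟩` of a family of matrices. -/
def tensorMatrix {L : I → FirstOrder.Language.{u, u}} (N : ∀ i, LMatrix (L i)) : LMatrix (tensorLang L) where
  carrier := ∀ i, (N i).carrier
  str :=
    { funMap := fun φ a i => (φ.1 i).realize (fun k => a k i)
      RelMap := fun r => r.elim }
  filter := {a | ∀ i, a i ∈ (N i).filter}

/-- The class `⨂ᵢ Kᵢ` of isomorphic copies of the matrices `⨂ᵢ ⟨Aᵢ, Fᵢ⟩` with `⟨Aᵢ, Fᵢ⟩ ∈ Kᵢ`. -/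
def tensorClass {L : I → FirstOrder.Language.{u, u}} (K : ∀ i, Set (LMatrix (L i))) :
    Set (LMatrix (tensorLang L)) :=
  isoClosure {M | ∃ N : ∀ i, LMatrix (L i), (∀ i, N i ∈ K i) ∧ M = tensorMatrix N}

/-- `M ≤_sd ⨂ᵢ ⟨Aᵢ, Fᵢ⟩`: the matrix `M` is (isomorphic to) a non-indexed subdirect product of the
matrices `⟨Aᵢ, Fᵢ⟩`, that is, a submatrix of `⨂ᵢ ⟨Aᵢ, Fᵢ⟩` whose projections are surjective. -/
def IsNonIndexedSubdirect {L : I → FirstOrder.Language.{u, u}} (M : LMatrix (tensorLang L))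
    (N : ∀ i, LMatrix (L i)) : Prop :=
  ∃ e : M.carrier ↪[tensorLang L] (tensorMatrix N).carrier, LMatrix.IsMatrixEmbedding e ∧
    ∀ i, Function.Surjective (fun a : M.carrier => (e a : ∀ i, (N i).carrier) i)

open Classical in
/-- The number of variables of `⨂ᵢ ⊢ᵢ`: the product of the cardinals `|Fm(⊢ᵢ)|`, and `ℵ₀` when
`I = ∅`. -/
def tensorCard (P : I → PropLogic.{u}) : Cardinal.{u} :=
  if IsEmpty I then ℵ₀ else Cardinal.prod (fun i => #(P i).Fm)

theorem aleph0_le_tensorCard (P : I → PropLogic.{u}) : ℵ₀ ≤ tensorCard P := by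
  classical
  unfold tensorCard
  split_ifs with h
  · exact le_rfl
  · rw [not_isEmpty_iff] at h
    obtain ⟨i₀⟩ := h
    have hvar : ∀ i, Nonempty (P i).Var := fun i => by
      rw [← mk_ne_zero_iff, mk_ord_toType]
      exact (aleph0_pos.trans_le (P i).aleph0_le_card).ne'
    have h1 : ℵ₀ ≤ #(P i₀).Fm := by
      refine (P i₀).aleph0_le_card.trans ?_
      conv_lhs => rw [← mk_ord_toType (P i₀).card]
      exact mk_le_of_injective (f := fun v => Term.var v) fun a b hab => by simpa using hab
    refine h1.trans ?_
    rw [← mk_pi]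
    let d : ∀ i, (P i).Fm := fun i => Term.var (hvar i).some
    refine mk_le_of_injective (f := fun t => Function.update d i₀ t) ?_
    exact Function.update_injective d i₀

/-- The non-indexed product `⨂ᵢ ⊢ᵢ` of a family of logics: the logic in the language `⨂ᵢ Lᵢ`
induced by the class of matrices `⨂ᵢ Mod^≡(⊢ᵢ)`, with the number of variables `tensorCard`. -/
def tensorLogic (P : I → PropLogic.{u}) : PropLogic.{u} :=
  PropLogic.induced (tensorLang fun i => (P i).lang)
    (tensorLang_noConst fun i => (P i).noConst) (tensorCard P) (aleph0_le_tensorCard P)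
    (tensorClass fun i => (P i).suszkoModels)

/-- A pair of logics, as a family with two members. -/
def pair (P Q : PropLogic.{u}) : ULift.{u} Bool → PropLogic.{u}
  | ⟨false⟩ => P
  | ⟨true⟩ => Q

end NonIndexed

end

end AAL

/-!
The four classes form a cycle of inclusions:
`Mod^≡(⨂ ⊢ᵢ) ⊆ P_sd(⨂ R(Mod(⊢ᵢ))) ⊆ P_sd(⨂ Mod^≡(⊢ᵢ)) ⊆ {M | M ≤_sd ⨂ Nᵢ} ⊆ Mod^≡(⨂ ⊢ᵢ)`.
Throughout, Suszko-reducedness is used in the following form (`PropLogic.mem_suszkoModels_iff`): a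
model is Suszko-reduced iff its points are separated by homomorphisms onto Leibniz-reduced models.
This makes `R(Mod(⊢)) ⊆ Mod^≡(⊢)`, hence the second inclusion, and the closure of `Mod^≡(⊢)` under
subdirect products immediate.

The first inclusion is the heart of the matter. Let `dᵢ` be the binary symbol that is the first
variable in the coordinate `i` and the second variable in the others. For a model `⟨A, F⟩` of
`⨂ ⊢ᵢ` and `f ∈ F` put `Fᵢ = {a : dᵢ(a, f) ∈ F}` (`coordFilter`). The rules `x, y ⊢ dᵢ(x, y)` and
`{dᵢ(x, y) : i ∈ I} ⊢ x` show that `F = ⋂ Fᵢ`, and therefore that `⋂ Ω Fᵢ` is contained in `Ω F`.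
The rules `y, {dᵢ(γ, y) : γ ∈ Γ} ⊢ dᵢ(φ, y)` show that `Fᵢ` is closed under every rule whose `i`-th
component holds in `Mod^≡(⊢ᵢ)` (`coordFilter_rule`). So, modulo `Ω Fᵢ`, the value of a term depends
on its `i`-th component only, and `⟨A, Fᵢ⟩*` is a Leibniz-reduced model of `⊢ᵢ` in disguise
(`restrict_coordFilter_mem`); in the language `⨂ Lᵢ` it is a non-indexed product in which all other
factors are trivial (`inflate_mem_tensorClass`). The homomorphisms `A → A / Ω Fᵢ`, for all
deductive filters that extend the given one, yield the subdirect representation. An empty `F` is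
treated separately: in this case some `⊢ᵢ` has no theorems and `⟨1, ∅⟩` is among its reduced models.

For the third inclusion the images of `M` in the products of the `i`-th factors serve as the `Nᵢ`.
For the fourth, the points of `M` are separated by the projections to the `Nᵢ`, and these in turn by
homomorphisms onto reduced models of `⊢ᵢ`, regarded as matrices in the language `⨂ Lᵢ`.
With two factors, `dᵢ` combines the coordinates of any two elements, so that a non-indexed
subdirect product is the whole product.
-/

namespace AAL

open FirstOrder FirstOrder.Language Cardinal

/-! ### Congruences and homomorphisms of matrices -/

namespace LMatrix

variable {L : FirstOrder.Language.{u, u}}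

/-- An equivalence relation is a congruence as soon as it is preserved when a single argument of a
basic operation is changed. -/
theorem isCongruence_of_update (M : LMatrix L) (θ : Setoid M.carrier)
    (h : ∀ (n : ℕ) (f : L.Functions n) (k : Fin n) (z : Fin n → M.carrier) (a b : M.carrier),
      θ a b → θ (Structure.funMap f (Function.update z k a))
        (Structure.funMap f (Function.update z k b))) : M.IsCongruence θ := by
  classical
  intro n f x y hxy
  have main : ∀ s : Finset (Fin n),
      θ (Structure.funMap f x) (Structure.funMap f (s.piecewise y x)) := by
    intro s
    induction s using Finset.induction_on with
    | empty => simp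
    | insert k s hk ih =>
      refine θ.trans ih ?_
      have hs := h n f k (s.piecewise y x) (x k) (y k) (hxy k)
      rw [← Finset.piecewise_insert] at hs
      rwa [Function.update_eq_self_iff.2 (by simp [hk])] at hs
  simpa only [Finset.piecewise_univ] using main Finset.univ

theorem IsCongruence.realize {M : LMatrix L} {θ : Setoid M.carrier} (hθ : M.IsCongruence θ)
    {X : Type*} (t : L.Term X) {v w : X → M.carrier} (h : ∀ x, θ (v x) (w x)) :
    θ (t.realize v) (t.realize w) := by
  induction t with
  | var x => exact h x
  | func f ts ih => exact hθ _ f _ _ ih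

theorem le_leibniz {M : LMatrix L} {θ : Setoid M.carrier} (h₁ : M.IsCongruence θ)
    (h₂ : M.IsCompatible θ) : θ ≤ M.leibniz :=
  M.isGreatest_leibniz.2 ⟨h₁, h₂⟩

theorem leibniz_of_filter_eq_empty {M : LMatrix L} (h : M.filter = ∅) (a b : M.carrier) :
    M.leibniz a b := by
  have : (⊤ : Setoid M.carrier) ≤ M.leibniz :=
    le_leibniz (fun _ _ _ _ _ => trivial) fun a _ _ ha => by simp [h] at ha
  exact this trivial

/-- Two elements that no unary polynomial with parameters in the algebra separates with respect to
the designated set are Leibniz congruent. Polynomials are terms in which the variable `none` stands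
for the argument and the other variables stand for the parameters. -/
theorem leibniz_of_polynomials (M : LMatrix L) {a b : M.carrier}
    (h : ∀ p : L.Term (Option M.carrier),
      p.realize (fun o => o.elim a id) ∈ M.filter ↔ p.realize (fun o => o.elim b id) ∈ M.filter) :
    M.leibniz a b := by
  classical
  let θ : Setoid M.carrier :=
    Setoid.ker fun a => {p : L.Term (Option M.carrier) |
      p.realize (fun o => o.elim a id) ∈ M.filter}
  have hθ' : ∀ a b, θ a b ↔ ∀ p : L.Term (Option M.carrier),
      p.realize (fun o => o.elim a id) ∈ M.filter ↔
        p.realize (fun o => o.elim b id) ∈ M.filter := fun a b => Set.ext_iff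
  have hθ : θ ≤ M.leibniz := by
    refine le_leibniz (M.isCongruence_of_update θ ?_) fun a b hab ha =>
      ((hθ' a b).1 hab (Term.var none)).1 ha
    intro n f k z a b hab
    refine (hθ' _ _).2 fun p => ?_
    let σ : Option M.carrier → L.Term (Option M.carrier) := fun o =>
      o.elim (Term.func f (Function.update (fun i => Term.var (some (z i))) k (Term.var none)))
        fun c => Term.var (some c)
    have key : ∀ c : M.carrier, (p.subst σ).realize (fun o => o.elim c id) =
        p.realize (fun o => o.elim (Structure.funMap f (Function.update z k c)) id) := by
      intro c
      rw [Term.realize_subst]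
      congr 1
      funext o
      cases o with
      | some d => rfl
      | none =>
        simp only [σ, Option.elim_none, Term.realize_func]
        congr 1
        funext i
        by_cases hi : i = k
        · subst hi; simp
        · simp [Function.update_of_ne hi]
    rw [← key, ← key]
    exact (hθ' a b).1 hab _
  exact hθ ((hθ' a b).2 h)

/-- Leibniz congruences are preserved by surjective homomorphisms that preserve and reflect the
designated sets; into a matrix with trivial Leibniz congruence, such a homomorphism therefore
identifies Leibniz congruent elements. -/
theorem leibniz_map {M N : LMatrix L} (h : M.carrier →[L] N.carrier) (hs : Function.Surjective h)
    (hF : ∀ a, a ∈ M.filter ↔ h a ∈ N.filter) (hN : N.leibniz = ⊥) {a b : M.carrier}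
    (hab : M.leibniz a b) : h a = h b := by
  have hker : Setoid.ker h ≤ M.leibniz := by
    refine le_leibniz ?_ ?_
    · intro n f x y hxy
      change h _ = h _
      rw [h.map_fun, h.map_fun]
      exact congrArg _ (funext hxy)
    · intro a b (hab : h a = h b) ha
      rwa [hF, ← hab, ← hF]
  let s := Function.surjInv hs
  have hsv : ∀ c, h (s c) = c := Function.surjInv_eq hs
  have hρ : Setoid.comap s M.leibniz ≤ N.leibniz := by
    refine le_leibniz ?_ ?_
    · intro n f x y hxy
      have hx : ∀ z : Fin n → N.carrier,
          M.leibniz (s (Structure.funMap f z)) (Structure.funMap f fun k => s (z k)) := fun z => by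
        refine hker ?_
        change h _ = h _
        rw [hsv, h.map_fun]
        exact congrArg _ (funext fun k => (hsv _).symm)
      exact M.leibniz.trans (hx x)
        (M.leibniz.trans (M.isCongruence_leibniz n f _ _ hxy) (M.leibniz.symm (hx y)))
    · intro c d hcd hc
      rw [← hsv d, ← hF]
      refine M.isCompatible_leibniz _ _ hcd ?_
      rwa [hF, hsv]
  have hh : ∀ c, M.leibniz (s (h c)) c := fun c => hker (hsv (h c))
  have : N.leibniz (h a) (h b) :=
    hρ (M.leibniz.trans (hh a) (M.leibniz.trans hab (M.leibniz.symm (hh b))))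
  rwa [hN] at this

/-- `h` is a homomorphism of matrices from `M` onto `N`; it need not reflect membership in the
designated sets. -/
def IsOnto {M N : LMatrix L} (h : M.carrier →[L] N.carrier) : Prop :=
  Function.Surjective h ∧ ∀ a ∈ M.filter, h a ∈ N.filter

theorem IsOnto.comp {M N R : LMatrix L} {h : M.carrier →[L] N.carrier}
    {g : N.carrier →[L] R.carrier} (hg : IsOnto g) (hh : IsOnto h) : IsOnto (g.comp h) :=
  ⟨hg.1.comp hh.1, fun a ha => hg.2 _ (hh.2 a ha)⟩

section Algebraic

variable [L.IsAlgebraic]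

/-- A map between algebras that preserves the basic operations is a homomorphism. -/
def homOfFun {M N : LMatrix L} (h : M.carrier → N.carrier)
    (hf : ∀ (n : ℕ) (f : L.Functions n) (x : Fin n → M.carrier),
      h (Structure.funMap f x) = Structure.funMap f (h ∘ x)) : M.carrier →[L] N.carrier where
  toFun := h
  map_fun' := fun f x => hf _ f x
  map_rel' := fun r => isEmptyElim r

/-- The projection of a matrix onto its reduction. -/
def toReduction (M : LMatrix L) : M.carrier →[L] M.reduction.carrier :=
  homOfFun (N := M.reduction) (Quotient.mk M.leibniz) fun n f x => by
    let : L.Prestructure M.leibniz :=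
      { toStructure := M.str
        fun_equiv := fun {n} {f} x y h => M.isCongruence_leibniz n f x y h
        rel_equiv := fun {_} {r} => isEmptyElim r }
    exact (funMap_quotient_mk' M.leibniz f x).symm

theorem toReduction_surjective (M : LMatrix L) : Function.Surjective M.toReduction :=
  Quotient.mk_surjective

theorem toReduction_eq_iff (M : LMatrix L) {a b : M.carrier} :
    M.toReduction a = M.toReduction b ↔ M.leibniz a b :=
  Quotient.eq

theorem toReduction_mem_iff (M : LMatrix L) (a : M.carrier) :
    a ∈ M.filter ↔ M.toReduction a ∈ M.reduction.filter := by
  refine ⟨fun h => ⟨a, h, rfl⟩, ?_⟩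
  rintro ⟨b, hb, hba⟩
  exact M.isCompatible_leibniz b a (M.toReduction_eq_iff.1 hba) hb

theorem leibniz_reduction (M : LMatrix L) : M.reduction.leibniz = ⊥ := by
  refine le_bot_iff.1 ?_
  intro c d hcd
  obtain ⟨a, rfl⟩ := M.toReduction_surjective c
  obtain ⟨b, rfl⟩ := M.toReduction_surjective d
  have : Setoid.comap M.toReduction M.reduction.leibniz ≤ M.leibniz := by
    refine le_leibniz ?_ ?_
    · intro n f x y hxy
      change M.reduction.leibniz _ _
      rw [M.toReduction.map_fun, M.toReduction.map_fun]
      exact M.reduction.isCongruence_leibniz n f _ _ hxy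
    · intro a b hab ha
      rw [toReduction_mem_iff] at ha ⊢
      exact M.reduction.isCompatible_leibniz _ _ hab ha
  exact M.toReduction_eq_iff.2 (this hcd)

/-- An isomorphism of matrices from a bijective strict homomorphism. -/
theorem iso_of_bijective {M N : LMatrix L} (h : M.carrier →[L] N.carrier)
    (hb : Function.Bijective h) (hF : ∀ a, a ∈ M.filter ↔ h a ∈ N.filter) : M.Iso N :=
  ⟨{ _root_.Equiv.ofBijective h hb with
      map_fun' := fun f x => h.map_fun f x
      map_rel' := fun r => isEmptyElim r }, hF⟩

end Algebraic

end LMatrix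

/-! ### Suszko-reduced models, reductions and subdirect products -/

open LMatrix

namespace PropLogic

variable {P : PropLogic.{u}}

theorem IsModel.of_strict {M N : LMatrix P.lang} (hN : P.IsModel N)
    (h : M.carrier →[P.lang] N.carrier) (hF : ∀ a, a ∈ M.filter ↔ h a ∈ N.filter) :
    P.IsModel M := by
  intro Γ φ hΓ v hv
  rw [hF, ← HomClass.realize_term]
  refine hN Γ φ hΓ _ fun γ hγ => ?_
  rw [HomClass.realize_term, ← hF]
  exact hv γ hγ

theorem IsModel.of_strict_surjective {M N : LMatrix P.lang} (hM : P.IsModel M)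
    (h : M.carrier →[P.lang] N.carrier) (hs : Function.Surjective h)
    (hF : ∀ a, a ∈ M.filter ↔ h a ∈ N.filter) : P.IsModel N := by
  intro Γ φ hΓ v hv
  obtain ⟨w, rfl⟩ : ∃ w, h ∘ w = v :=
    ⟨fun x => Function.surjInv hs (v x), funext fun x => Function.surjInv_eq hs _⟩
  rw [HomClass.realize_term, ← hF]
  refine hM Γ φ hΓ w fun γ hγ => ?_
  rw [hF, ← HomClass.realize_term]
  exact hv γ hγ

theorem IsModel.reduction {M : LMatrix P.lang} (hM : P.IsModel M) : P.IsModel M.reduction :=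
  hM.of_strict_surjective M.toReduction M.toReduction_surjective M.toReduction_mem_iff

/-- Up to isomorphism, the reductions of models are the models with the identity as their Leibniz
congruence. -/
theorem mem_reducedClass_models {M : LMatrix P.lang} :
    M ∈ reducedClass P.models ↔ P.IsModel M ∧ M.leibniz = ⊥ := by
  constructor
  · rintro ⟨_, ⟨N, hN, rfl⟩, e, he⟩
    refine ⟨(IsModel.reduction hN).of_strict e.toHom he, le_bot_iff.1 fun a b hab => ?_⟩
    exact e.injective (leibniz_map e.toHom e.surjective he N.leibniz_reduction hab)
  · rintro ⟨hM, h⟩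
    refine ⟨M.reduction, ⟨M, hM, rfl⟩, iso_of_bijective M.toReduction
      ⟨fun a b hab => ?_, M.toReduction_surjective⟩ M.toReduction_mem_iff⟩
    have := M.toReduction_eq_iff.1 hab
    rwa [h] at this

/-- A model is Suszko-reduced if and only if its points are separated by the homomorphisms onto
Leibniz-reduced models: such homomorphisms correspond to the deductive filters that extend the
designated set. -/
theorem mem_suszkoModels_iff {M : LMatrix P.lang} :
    M ∈ P.suszkoModels ↔ P.IsModel M ∧ ∀ a b : M.carrier, a ≠ b →
      ∃ N ∈ reducedClass P.models, ∃ h : M.carrier →[P.lang] N.carrier, IsOnto h ∧ h a ≠ h b := by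
  constructor
  · rintro ⟨hM, hS⟩
    refine ⟨hM, fun a b hab => ?_⟩
    have : ¬ P.suszko M a b := by rw [hS]; exact hab
    obtain ⟨G, hG, hFG, hnot⟩ : ∃ G : Set M.carrier, P.IsModel (M.withFilter G) ∧
        M.filter ⊆ G ∧ ¬ (M.withFilter G).leibniz a b := by
      by_contra! hcon
      refine this ?_
      rintro _ ⟨G, hG, hFG, rfl⟩
      exact hcon G hG hFG
    refine ⟨_, ⟨_, ⟨M.withFilter G, hG, rfl⟩, Language.Equiv.refl _ _, fun _ => Iff.rfl⟩,
      (M.withFilter G).toReduction,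
      ⟨toReduction_surjective _, fun a ha =>
        (toReduction_mem_iff (M.withFilter G) a).1 (hFG ha)⟩, fun h => ?_⟩
    exact hnot ((toReduction_eq_iff _).1 h)
  · rintro ⟨hM, hsep⟩
    refine ⟨hM, le_bot_iff.1 fun a b hab => ?_⟩
    by_contra hne
    obtain ⟨N, hN, h, ⟨hs, hF⟩, hh⟩ := hsep a b hne
    obtain ⟨hNm, hNl⟩ := mem_reducedClass_models.1 hN
    have hle : P.suszko M ≤ (M.withFilter (h ⁻¹' N.filter)).leibniz :=
      sInf_le ⟨_, hNm.of_strict (M := M.withFilter (h ⁻¹' N.filter)) h fun _ => Iff.rfl, hF, rfl⟩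
    exact hh (leibniz_map (M := M.withFilter (h ⁻¹' N.filter)) h hs (fun _ => Iff.rfl) hNl
      (hle hab))

theorem reducedClass_models_subset_suszkoModels :
    reducedClass P.models ⊆ P.suszkoModels := fun M hM =>
  mem_suszkoModels_iff.2 ⟨(mem_reducedClass_models.1 hM).1, fun _ _ hab =>
    ⟨M, hM, Hom.id _ _, ⟨Function.surjective_id, fun _ => id⟩, hab⟩⟩

/-- A matrix whose points are separated by homomorphisms onto Suszko-reduced models is
Suszko-reduced if it is a model. -/
theorem mem_suszkoModels_of_separated {M : LMatrix P.lang} (hM : P.IsModel M)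
    (h : ∀ a b : M.carrier, a ≠ b →
      ∃ N ∈ P.suszkoModels, ∃ h : M.carrier →[P.lang] N.carrier, IsOnto h ∧ h a ≠ h b) :
    M ∈ P.suszkoModels := by
  refine mem_suszkoModels_iff.2 ⟨hM, fun a b hab => ?_⟩
  obtain ⟨N, hN, h, hh, hne⟩ := h a b hab
  obtain ⟨R, hR, g, hg, hne'⟩ := (mem_suszkoModels_iff.1 hN).2 _ _ hne
  exact ⟨R, hR, g.comp h, hg.comp hh, hne'⟩

end PropLogic

section Subdirect

variable {L : FirstOrder.Language.{u, u}}

theorem subdirectProducts_mono {K K' : Set (LMatrix L)} (h : K ⊆ K') :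
    subdirectProducts K ⊆ subdirectProducts K' := by
  rintro M ⟨J, N, hN, e⟩
  exact ⟨J, N, fun j => h (hN j), e⟩

variable [L.IsAlgebraic]

/-- The projections of a direct product. -/
def prodProj {J : Type u} (N : J → LMatrix L) (j : J) :
    (LMatrix.prod N).carrier →[L] (N j).carrier :=
  homOfFun (M := LMatrix.prod N) (fun a => a j) fun _ _ _ => rfl

/-- A matrix is a subdirect product of members of `K` if its points are separated, and its
designated set is cut out, by homomorphisms onto members of `K`. -/
theorem mem_subdirectProducts_of_separated {K : Set (LMatrix L)} {M : LMatrix L}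
    (h₁ : ∀ a b : M.carrier, a ≠ b →
      ∃ N ∈ K, ∃ h : M.carrier →[L] N.carrier, IsOnto h ∧ h a ≠ h b)
    (h₂ : ∀ a, a ∉ M.filter →
      ∃ N ∈ K, ∃ h : M.carrier →[L] N.carrier, IsOnto h ∧ h a ∉ N.filter) :
    M ∈ subdirectProducts K := by
  choose N₁ hN₁ f₁ hf₁ hne using h₁
  choose N₂ hN₂ f₂ hf₂ hnot using h₂
  -- The index set consists of the pairs of points and the points to be separated.
  let J : Type u := {p : M.carrier × M.carrier // p.1 ≠ p.2} ⊕ {a : M.carrier // a ∉ M.filter}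
  let N : J → LMatrix L := Sum.elim (fun p => N₁ p.1.1 p.1.2 p.2) fun a => N₂ a.1 a.2
  let f : ∀ j, M.carrier →[L] (N j).carrier := fun j => match j with
    | Sum.inl p => f₁ p.1.1 p.1.2 p.2
    | Sum.inr a => f₂ a.1 a.2
  have hf : ∀ j, IsOnto (f j) := by
    rintro (p | a)
    · exact hf₁ _ _ _
    · exact hf₂ _ _
  let g : M.carrier →[L] (LMatrix.prod N).carrier :=
    homOfFun (N := LMatrix.prod N) (fun a j => f j a) fun n F x =>
      funext fun j => (f j).map_fun F x
  have hg : Function.Injective g := by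
    intro a b hab
    by_contra hn
    exact hne a b hn (congrFun hab (Sum.inl ⟨(a, b), hn⟩))
  refine ⟨J, N, ?_, Embedding.ofInjective hg, ?_, fun j => (hf j).1⟩
  · rintro (p | a)
    · exact hN₁ _ _ _
    · exact hN₂ _ _
  · intro a
    refine ⟨fun ha j => (hf j).2 a ha, fun ha => ?_⟩
    by_contra hn
    exact hnot a hn (ha (Sum.inr ⟨a, hn⟩))

theorem subdirectProducts_suszkoModels_subset (P : PropLogic.{u}) :
    subdirectProducts P.suszkoModels ⊆ P.suszkoModels := by
  rintro M ⟨J, N, hN, e, he, hs⟩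
  have hM : P.IsModel M := by
    refine PropLogic.IsModel.of_strict (N := LMatrix.prod N) ?_ e.toHom he
    intro Γ φ hΓ v hv j
    change prodProj N j (φ.realize v) ∈ (N j).filter
    rw [← HomClass.realize_term]
    refine (hN j).1 Γ φ hΓ _ fun γ hγ => ?_
    rw [HomClass.realize_term]
    exact hv γ hγ j
  refine PropLogic.mem_suszkoModels_of_separated hM fun a b hab => ?_
  obtain ⟨j, hj⟩ : ∃ j, (e a : ∀ j, (N j).carrier) j ≠ (e b : ∀ j, (N j).carrier) j := by
    by_contra! h
    exact hab (e.injective (funext h))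
  exact ⟨N j, hN j, (prodProj N j).comp e.toHom, ⟨hs j, fun a ha => (he a).1 ha j⟩, hj⟩

end Subdirect

noncomputable section

/-! ### Terms of the non-indexed product and their components -/

theorem subst_subst {L : FirstOrder.Language.{u, u}} {X Y Z : Type*} (t : L.Term X)
    (σ : X → L.Term Y) (τ : Y → L.Term Z) :
    (t.subst σ).subst τ = t.subst fun x => (σ x).subst τ := by
  induction t with
  | var x => rfl
  | func f ts ih => simp [ih]

theorem subst_var {L : FirstOrder.Language.{u, u}} {X : Type*} (t : L.Term X) :
    t.subst Term.var = t := by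
  induction t with
  | var x => rfl
  | func f ts ih => simp [ih]

theorem realize_congr_varFinset {L : FirstOrder.Language.{u, u}} {A : Type*} [L.Structure A]
    {X : Type*} [DecidableEq X] (t : L.Term X) {v w : X → A} (h : ∀ x ∈ t.varFinset, v x = w x) :
    t.realize v = t.realize w := by
  induction t with
  | var x => exact h x (by simp [Term.varFinset])
  | func f ts ih =>
    simp only [Term.realize_func]
    congr 1
    funext k
    exact ih k fun x hx => h x (Finset.mem_biUnion.2 ⟨k, Finset.mem_univ k, hx⟩)

/-- A finite set embeds into any infinite set, with a left inverse. -/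
theorem exists_leftInvOn_finset {A X : Type u} [Nonempty A] [Infinite X] (S : Finset A) :
    ∃ (f : A → X) (w : X → A), ∀ a ∈ S, w (f a) = a := by
  classical
  let g : S ↪ X :=
    (S.equivFin.toEmbedding.trans Fin.valEmbedding).trans (Infinite.natEmbedding X)
  refine ⟨fun a => if h : a ∈ S then g ⟨a, h⟩ else Infinite.natEmbedding X 0,
    Function.extend g Subtype.val fun _ => Classical.arbitrary A, fun a ha => ?_⟩
  simp only [dif_pos ha]
  exact g.injective.extend_apply _ _ _

section Terms

variable {I : Type u} {L : I → FirstOrder.Language.{u, u}}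

/-- The `i`-th component of a term of `⨂ᵢ Lᵢ`: every symbol `⟨φⱼ : j ∈ I⟩` is replaced by `φᵢ`. -/
def component (i : I) {X : Type*} (t : (tensorLang L).Term X) : (L i).Term X :=
  t.substFunc fun φ => φ.1 i

@[simp]
theorem component_var (i : I) {X : Type*} (x : X) :
    component i (Term.var x : (tensorLang L).Term X) = Term.var x :=
  rfl

@[simp]
theorem component_func (i : I) {X : Type*} {n : ℕ} (φ : (tensorLang L).Functions n)
    (ts : Fin n → (tensorLang L).Term X) :
    component i (Term.func φ ts) = (φ.1 i).subst fun k => component i (ts k) :=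
  rfl

theorem component_term (i : I) {n : ℕ} (φ : (tensorLang L).Functions n) :
    component i (Functions.term φ) = φ.1 i :=
  subst_var _

theorem component_subst (i : I) {X Y : Type*} (t : (tensorLang L).Term X)
    (σ : X → (tensorLang L).Term Y) :
    component i (t.subst σ) = (component i t).subst fun x => component i (σ x) := by
  induction t with
  | var x => rfl
  | func f ts ih => simp [ih, subst_subst]

open Classical in
/-- The symbol of `⨂ᵢ Lᵢ` whose `i`-th component is the formula `t`, all other components being the
variable `x_k`. -/
def singleSymbol (i : I) {n : ℕ} (k : Fin n) (t : (L i).Term (Fin n)) :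
    (tensorLang L).Functions n :=
  ⟨Function.update (β := fun j => (L j).Term (Fin n)) (fun _ => Term.var k) i t, ⟨i⟩⟩

@[simp]
theorem singleSymbol_self (i : I) {n : ℕ} (k : Fin n) (t : (L i).Term (Fin n)) :
    (singleSymbol i k t).1 i = t := by
  simp [singleSymbol]

@[simp]
theorem singleSymbol_of_ne {i j : I} (h : j ≠ i) {n : ℕ} (k : Fin n) (t : (L i).Term (Fin n)) :
    (singleSymbol i k t).1 j = Term.var k := by
  simp [singleSymbol, h]

/-- The decomposition term `dᵢ(s, t)`, with the `i`-th component of `s` and the other components of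
`t`. -/
def decompTerm (i : I) {X : Type*} (s t : (tensorLang L).Term X) : (tensorLang L).Term X :=
  Term.func (singleSymbol i 1 (Term.var 0)) ![s, t]

@[simp]
theorem component_decompTerm_self (i : I) {X : Type*} (s t : (tensorLang L).Term X) :
    component i (decompTerm i s t) = component i s := by
  simp [decompTerm]

@[simp]
theorem component_decompTerm_of_ne {i j : I} (h : j ≠ i) {X : Type*}
    (s t : (tensorLang L).Term X) : component j (decompTerm i s t) = component j t := by
  simp [decompTerm, h]

/-- The operation `dᵢ` of an algebra in the language `⨂ᵢ Lᵢ`. -/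
def decomp (M : LMatrix (tensorLang L)) (i : I) (a b : M.carrier) : M.carrier :=
  Structure.funMap (singleSymbol (L := L) i 1 (Term.var 0)) ![a, b]

@[simp]
theorem realize_decompTerm (M : LMatrix (tensorLang L)) (i : I) {X : Type*}
    (s t : (tensorLang L).Term X) (v : X → M.carrier) :
    (decompTerm i s t).realize v = decomp M i (s.realize v) (t.realize v) := by
  simp only [decompTerm, decomp, Term.realize_func]
  congr 1
  funext k
  fin_cases k <;> rfl

/-- The symbol of `⨂ᵢ Lᵢ` acting as the basic operation `f` in the coordinate `i`. The other
components are the first variable, which exists because there are no nullary symbols. -/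
def liftSymbol {i : I} (hi : IsEmpty ((L i).Functions 0)) {n : ℕ} (f : (L i).Functions n) :
    (tensorLang L).Functions n :=
  singleSymbol i ⟨0, Nat.pos_of_ne_zero (by rintro rfl; exact hi.false f)⟩ (Functions.term f)

/-- A term of `⨂ᵢ Lᵢ` with a given `i`-th component. -/
def liftTerm {i : I} (hi : IsEmpty ((L i).Functions 0)) {X : Type*} (s : (L i).Term X) :
    (tensorLang L).Term X :=
  s.substFunc fun f => Functions.term (liftSymbol hi f)

@[simp]
theorem component_liftTerm {i : I} (hi : IsEmpty ((L i).Functions 0)) {X : Type*}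
    (s : (L i).Term X) : component i (liftTerm hi s) = s := by
  induction s with
  | var x => rfl
  | func f ts ih =>
    change component i ((Functions.term (liftSymbol hi f)).subst fun k => liftTerm hi (ts k)) = _
    rw [component_subst, component_term, liftSymbol, singleSymbol_self]
    simp [ih, Functions.term]

/-! ### Non-indexed products and matrices depending on one coordinate -/

/-- The projection of a non-indexed product to the coordinate `i`. -/
def tensorProj (N : ∀ i, LMatrix (L i)) (i : I) (a : (tensorMatrix N).carrier) : (N i).carrier :=
  a i

theorem tensorProj_realize (N : ∀ i, LMatrix (L i)) (i : I) {X : Type*}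
    (t : (tensorLang L).Term X) (v : X → (tensorMatrix N).carrier) :
    tensorProj N i (t.realize v) = (component i t).realize fun x => tensorProj N i (v x) := by
  induction t with
  | var x => rfl
  | func φ ts ih =>
    rw [component_func, Term.realize_subst]
    simp only [← ih]
    rfl

theorem tensorProj_surjective (N : ∀ i, LMatrix (L i)) (i : I) :
    Function.Surjective (tensorProj N i) := by
  classical
  intro c
  let a : ∀ j, (N j).carrier := Function.update (fun j => Classical.arbitrary (N j).carrier) i c
  have ha : a i = c := Function.update_self i _ _
  exact ⟨a, ha⟩

/-- The matrix in the language `⨂ᵢ Lᵢ` obtained from a matrix `C` in the language `Lᵢ` by letting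
the symbols act through their `i`-th component. It is isomorphic to the non-indexed product of `C` and
trivial matrices. -/
def inflate (i : I) (C : LMatrix (L i)) : LMatrix (tensorLang L) where
  carrier := C.carrier
  str :=
    { funMap := fun φ a => (φ.1 i).realize a
      RelMap := fun r => r.elim }
  filter := C.filter

/-- The homomorphism of a non-indexed product onto an inflated factor. -/
def tensorProjHom (N : ∀ i, LMatrix (L i)) (i : I) :
    (tensorMatrix N).carrier →[tensorLang L] (inflate i (N i)).carrier :=
  homOfFun (M := tensorMatrix N) (N := inflate i (N i)) (tensorProj N i) fun _ _ _ => rfl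

/-- A homomorphism of `Lᵢ`-algebras is a homomorphism of the inflated algebras. -/
def inflateHom {i : I} {C D : LMatrix (L i)} (h : C.carrier →[L i] D.carrier) :
    (inflate i C).carrier →[tensorLang L] (inflate i D).carrier :=
  homOfFun (M := inflate i C) (N := inflate i D) (fun c => h c) fun _ φ x =>
    (HomClass.realize_term (M := C.carrier) h (t := φ.1 i) (v := x)).symm

/-- The `Lᵢ`-matrix on the carrier of a matrix in the language `⨂ᵢ Lᵢ` whose basic operations are
interpreted by the symbols that act in the coordinate `i`. -/
def restrict {i : I} [(L i).IsAlgebraic] (hi : IsEmpty ((L i).Functions 0))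
    (D : LMatrix (tensorLang L)) : LMatrix (L i) where
  carrier := D.carrier
  str :=
    { funMap := fun f x => Structure.funMap (liftSymbol hi f) x
      RelMap := fun r => isEmptyElim r }
  filter := D.filter

theorem realize_restrict {i : I} [(L i).IsAlgebraic] (hi : IsEmpty ((L i).Functions 0))
    (D : LMatrix (tensorLang L)) {X : Type*} (s : (L i).Term X) (v : X → D.carrier) :
    Term.realize (M := (restrict hi D).carrier) v s = (liftTerm hi s).realize v := by
  induction s with
  | var x => rfl
  | func f ts ih =>
    simp only [liftTerm] at ih
    simp only [liftTerm, Term.substFunc, Term.realize_subst, ← ih]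
    rfl

/-- The algebra of `D` depends on the coordinate `i` only: terms with the same `i`-th component
have the same values. -/
def DependsOnlyOn (i : I) (D : LMatrix (tensorLang L)) : Prop :=
  ∀ s t : (tensorLang L).Term D.carrier, component i s = component i t →
    s.realize id = t.realize id

theorem DependsOnlyOn.realize_eq {i : I} {D : LMatrix (tensorLang L)} (hD : DependsOnlyOn i D)
    {X : Type*} {s t : (tensorLang L).Term X} (h : component i s = component i t)
    (v : X → D.carrier) : s.realize v = t.realize v := by
  have := hD (s.subst fun x => Term.var (v x)) (t.subst fun x => Term.var (v x))
    (by rw [component_subst, component_subst, h])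
  simpa only [Term.realize_subst, Term.realize_var, id] using this

theorem DependsOnlyOn.funMap_eq {i : I} [(L i).IsAlgebraic] (hi : IsEmpty ((L i).Functions 0))
    {D : LMatrix (tensorLang L)} (hD : DependsOnlyOn i D) {n : ℕ} (φ : (tensorLang L).Functions n)
    (x : Fin n → D.carrier) :
    Structure.funMap φ x = Term.realize (M := (restrict hi D).carrier) x (φ.1 i) := by
  rw [realize_restrict]
  refine hD.realize_eq (s := Functions.term φ) ?_ x
  rw [component_term, component_liftTerm]

/-- A matrix that depends on the coordinate `i` only is the inflation of an `Lᵢ`-matrix. -/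
def DependsOnlyOn.toInflate {i : I} [(L i).IsAlgebraic] (hi : IsEmpty ((L i).Functions 0))
    {D : LMatrix (tensorLang L)} (hD : DependsOnlyOn i D) :
    D.carrier →[tensorLang L] (inflate i (restrict hi D)).carrier :=
  homOfFun (N := inflate i (restrict hi D)) id fun _ φ x => hD.funMap_eq hi φ x

theorem DependsOnlyOn.leibniz_restrict {i : I} [(L i).IsAlgebraic]
    (hi : IsEmpty ((L i).Functions 0)) {D : LMatrix (tensorLang L)} (hD : DependsOnlyOn i D)
    (h : D.leibniz = ⊥) : (restrict hi D).leibniz = ⊥ := by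
  refine le_bot_iff.1 (le_trans ?_ h.le)
  refine le_leibniz (M := D) ?_ (restrict hi D).isCompatible_leibniz
  intro n φ x y hxy
  rw [hD.funMap_eq hi, hD.funMap_eq hi]
  exact (restrict hi D).isCongruence_leibniz.realize _ hxy

theorem funMap_liftSymbol_inflate {i : I} (hi : IsEmpty ((L i).Functions 0)) (C : LMatrix (L i))
    {n : ℕ} (f : (L i).Functions n) (z : Fin n → C.carrier) :
    Structure.funMap (M := (inflate i C).carrier) (liftSymbol hi f) z = Structure.funMap f z := by
  change ((liftSymbol hi f).1 i).realize z = _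
  rw [liftSymbol, singleSymbol_self]
  rfl

theorem leibniz_inflate {i : I} (hi : IsEmpty ((L i).Functions 0)) {C : LMatrix (L i)}
    (h : C.leibniz = ⊥) : (inflate i C).leibniz = ⊥ := by
  refine le_bot_iff.1 (le_trans ?_ h.le)
  refine le_leibniz (M := C) ?_ (inflate i C).isCompatible_leibniz
  intro n f x y hxy
  rw [← funMap_liftSymbol_inflate hi, ← funMap_liftSymbol_inflate hi]
  exact (inflate i C).isCongruence_leibniz n _ _ _ hxy

end Terms

/-! ### One-element matrices -/

/-- The one-element matrix with designated set `F`. -/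
def pointMatrix (L : FirstOrder.Language.{u, u}) [L.IsAlgebraic] (F : Set PUnit.{u + 1}) :
    LMatrix L where
  carrier := PUnit
  str :=
    { funMap := fun _ _ => PUnit.unit
      RelMap := fun r => isEmptyElim r }
  filter := F

theorem pointMatrix_univ_mem_reducedClass (P : PropLogic.{u}) :
    pointMatrix P.lang Set.univ ∈ reducedClass P.models :=
  PropLogic.mem_reducedClass_models.2 ⟨fun _ _ _ _ _ => trivial,
    le_bot_iff.1 fun _ _ _ => rfl⟩

theorem pointMatrix_empty_mem_reducedClass {P : PropLogic.{u}} (h : ∀ φ, ¬ P.Entails ∅ φ) :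
    pointMatrix P.lang ∅ ∈ reducedClass P.models := by
  refine PropLogic.mem_reducedClass_models.2 ⟨fun Γ φ hΓ v hv => ?_, le_bot_iff.1 fun _ _ _ => rfl⟩
  obtain rfl : Γ = ∅ := Set.eq_empty_iff_forall_notMem.2 fun γ hγ => hv γ hγ
  exact absurd hΓ (h φ)

/-! ### Models of the non-indexed product of logics -/

theorem LMatrix.Iso.symm {L : FirstOrder.Language.{u, u}} {M N : LMatrix L} (h : M.Iso N) :
    N.Iso M := by
  obtain ⟨e, he⟩ := h
  exact ⟨e.symm, fun a => by rw [he, e.apply_symm_apply]⟩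

theorem inflate_mem_tensorClass {I : Type u} {L : I → FirstOrder.Language.{u, u}}
    [∀ i, (L i).IsAlgebraic] {K : ∀ i, Set (LMatrix (L i))}
    (hK : ∀ i, pointMatrix (L i) Set.univ ∈ K i) {i : I} {C : LMatrix (L i)} (hC : C ∈ K i) :
    inflate i C ∈ tensorClass K := by
  classical
  obtain ⟨N, rfl, hN⟩ : ∃ N : ∀ j, LMatrix (L j), N i = C ∧
      ∀ j, j ≠ i → N j = pointMatrix (L j) Set.univ :=
    ⟨Function.update (fun j => pointMatrix (L j) Set.univ) i C, by simp, fun j hj => by simp [hj]⟩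
  refine ⟨_, ⟨N, fun j => ?_, rfl⟩, Iso.symm (iso_of_bijective (tensorProjHom N i) ⟨?_, ?_⟩ ?_)⟩
  · by_cases hj : j = i
    · subst hj; exact hC
    · rw [hN j hj]; exact hK j
  · intro a b hab
    funext j
    by_cases hj : j = i
    · subst hj; exact hab
    · have : Subsingleton (N j).carrier := by
        rw [hN j hj]; exact inferInstanceAs (Subsingleton PUnit)
      exact Subsingleton.elim _ _
  · exact tensorProj_surjective N i
  · intro a
    refine ⟨fun ha => ha i, fun ha j => ?_⟩
    by_cases hj : j = i
    · subst hj; exact ha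
    · have : (N j).filter = Set.univ := by rw [hN j hj]; rfl
      rw [this]; trivial

variable {I : Type u} {P : I → PropLogic.{u}}

theorem card_le_tensorCard (P : I → PropLogic.{u}) (i : I) : (P i).card ≤ tensorCard P := by
  classical
  have hvar : ∀ j, Nonempty (P j).Var := fun j => by
    rw [← mk_ne_zero_iff, mk_ord_toType]
    exact (aleph0_pos.trans_le (P j).aleph0_le_card).ne'
  have hi : ¬ IsEmpty I := not_isEmpty_iff.2 ⟨i⟩
  rw [tensorCard, if_neg hi, ← mk_pi]
  conv_lhs => rw [← mk_ord_toType (P i).card]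
  let d : ∀ j, (P j).Fm := fun j => Term.var (hvar j).some
  refine mk_le_of_injective (f := fun x => Function.update d i (Term.var x)) ?_
  exact (Function.update_injective d i).comp fun x y h => by simpa using h

theorem mk_option_le_tensorCard {X : Type u} (hX : #X ≤ tensorCard P) :
    #(Option X) ≤ tensorCard P := by
  rw [mk_option]
  exact add_le_of_le (aleph0_le_tensorCard P) hX
    (one_le_aleph0.trans (aleph0_le_tensorCard P))

/-- The models of `⨂ᵢ ⊢ᵢ` satisfy every rule, over a set of at most `tensorCard P` variables, that
is valid in all non-indexed products of Suszko-reduced models. Validity is expressed coordinatewise. -/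
theorem tensorLogic_rule {M : LMatrix (tensorLang fun i => (P i).lang)}
    (hM : (tensorLogic P).IsModel M) {X : Type u} (hX : #X ≤ tensorCard P)
    (Γ : Set ((tensorLang fun i => (P i).lang).Term X))
    (φ : (tensorLang fun i => (P i).lang).Term X)
    (hval : ∀ N : ∀ i, LMatrix (P i).lang, (∀ i, N i ∈ (P i).suszkoModels) →
      ∀ v : ∀ i, X → (N i).carrier,
        (∀ γ ∈ Γ, ∀ i, (component i γ).realize (v i) ∈ (N i).filter) →
        ∀ i, (component i φ).realize (v i) ∈ (N i).filter)
    (v : X → M.carrier) (hv : ∀ γ ∈ Γ, γ.realize v ∈ M.filter) : φ.realize v ∈ M.filter := by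
  obtain ⟨ι⟩ : Nonempty (X ↪ (tensorCard P).ord.ToType) := by
    rw [← Cardinal.le_def, mk_ord_toType]; exact hX
  let rn : (tensorLang fun i => (P i).lang).Term X →
      (tensorLang fun i => (P i).lang).Term (tensorCard P).ord.ToType := fun t => t.relabel ι
  have hE : (tensorLogic P).Entails (rn '' Γ) (rn φ) := by
    rintro M' ⟨_, ⟨N, hN, rfl⟩, e, he⟩ w hw
    have key : ∀ t i, tensorProj N i (e ((rn t).realize w)) =
        (component i t).realize fun x => tensorProj N i (e (w (ι x))) := by
      intro t i
      rw [← HomClass.realize_term]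
      change tensorProj N i ((t.relabel ι).realize _) = _
      rw [Term.realize_relabel, tensorProj_realize]
      rfl
    rw [he]
    intro i
    change tensorProj N i _ ∈ _
    rw [key]
    refine hval N hN (fun i x => tensorProj N i (e (w (ι x)))) (fun γ hγ i => ?_) i
    rw [← key]
    exact (he _).1 (hw _ ⟨γ, hγ, rfl⟩) i
  have hext : ∀ t, (rn t).realize (Function.extend ι v fun _ => Classical.arbitrary _) =
      t.realize v := by
    intro t
    change (t.relabel ι).realize _ = _
    rw [Term.realize_relabel]
    congr 1
    exact funext fun x => ι.injective.extend_apply _ _ _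
  rw [← hext]
  refine hM _ _ hE _ ?_
  rintro _ ⟨γ, hγ, rfl⟩
  have := hv γ hγ
  rw [← hext] at this
  exact this

theorem tensorLogic_isModel_of_mem {M : LMatrix (tensorLang fun i => (P i).lang)}
    (hM : M ∈ tensorClass fun i => (P i).suszkoModels) : (tensorLogic P).IsModel M :=
  fun _ _ hΓ v hv => hΓ M hM v hv

/-- If every factor has a theorem, then so has the non-indexed product. -/
theorem filter_nonempty_of_theorems {M : LMatrix (tensorLang fun i => (P i).lang)}
    (hM : (tensorLogic P).IsModel M) (h : ∀ i, ∃ φ, (P i).Entails ∅ φ) : M.filter.Nonempty := by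
  have hX : #PUnit.{u + 1} ≤ tensorCard P := by
    rw [mk_punit]; exact one_le_aleph0.trans (aleph0_le_tensorCard P)
  let v : PUnit.{u + 1} → M.carrier := fun _ => Classical.arbitrary _
  choose φ hφ using h
  by_cases hI : Nonempty I
  · -- Identifying all variables turns each theorem into a unary formula.
    let T : (tensorLang fun i => (P i).lang).Functions 1 :=
      ⟨fun i => (φ i).subst fun _ => Term.var 0, hI⟩
    refine ⟨_, tensorLogic_rule hM hX ∅ (Term.func T fun _ => Term.var PUnit.unit) ?_ v
      fun γ hγ => hγ.elim⟩
    intro N hN w _ i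
    rw [component_func, Term.realize_subst, Term.realize_subst]
    exact (hN i).1 ∅ (φ i) (hφ i) _ fun γ hγ => hγ.elim
  · exact ⟨_, tensorLogic_rule hM hX ∅ (Term.var PUnit.unit)
      (fun _ _ _ _ i => (hI ⟨i⟩).elim) v fun γ hγ => hγ.elim⟩

/-! ### The coordinate filters of a model -/

/-- The `i`-th coordinate filter `{a : dᵢ(a, f) ∈ F}` of a matrix `⟨A, F⟩`. If `⟨A, F⟩` is a
non-indexed product `⨂ᵢ ⟨Aᵢ, Fᵢ⟩` and `f ∈ F`, it consists of the elements with `i`-th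
coordinate in `Fᵢ`. -/
def coordFilter (M : LMatrix (tensorLang fun i => (P i).lang)) (f : M.carrier) (i : I) :
    Set M.carrier :=
  {a | decomp M i a f ∈ M.filter}

section CoordFilter

variable {M : LMatrix (tensorLang fun i => (P i).lang)} {f : M.carrier}

/-- The rule `x, y ⊢ dᵢ(x, y)`. -/
theorem filter_subset_coordFilter (hM : (tensorLogic P).IsModel M) (hf : f ∈ M.filter) (i : I) :
    M.filter ⊆ coordFilter M f i := by
  intro a ha
  have hX : #(ULift.{u} Bool) ≤ tensorCard P := (mk_le_aleph0).trans (aleph0_le_tensorCard P)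
  have := tensorLogic_rule hM hX (Set.range Term.var)
    (decompTerm i (Term.var ⟨true⟩) (Term.var ⟨false⟩)) ?_ (fun b => if b.down then a else f) ?_
  · rw [realize_decompTerm] at this
    exact this
  · intro N _ v hv j
    by_cases hj : j = i
    · subst hj
      simpa using hv _ ⟨⟨true⟩, rfl⟩ j
    · simpa [hj] using hv _ ⟨⟨false⟩, rfl⟩ j
  · rintro _ ⟨⟨_ | _⟩, rfl⟩
    · exact hf
    · exact ha

/-- The rule `{dᵢ(x, y) : i ∈ I} ⊢ x`. -/
theorem mem_filter_of_mem_coordFilter (hM : (tensorLogic P).IsModel M) {a : M.carrier}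
    (ha : ∀ i, a ∈ coordFilter M f i) : a ∈ M.filter := by
  have hX : #(ULift.{u} Bool) ≤ tensorCard P := (mk_le_aleph0).trans (aleph0_le_tensorCard P)
  refine tensorLogic_rule hM hX
    (Set.range fun i => decompTerm i (Term.var ⟨true⟩) (Term.var ⟨false⟩))
    (Term.var ⟨true⟩) ?_ (fun b => if b.down then a else f) ?_
  · intro N _ v hv i
    simpa using hv _ ⟨i, rfl⟩ i
  · rintro _ ⟨i, rfl⟩
    rw [realize_decompTerm]
    exact ha i

theorem leibniz_of_leibniz_coordFilter (hM : (tensorLogic P).IsModel M) (hf : f ∈ M.filter)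
    {a b : M.carrier} (h : ∀ i, (M.withFilter (coordFilter M f i)).leibniz a b) :
    M.leibniz a b := by
  let θ : Setoid M.carrier :=
    { r := fun a b => ∀ i, (M.withFilter (coordFilter M f i)).leibniz a b
      iseqv := ⟨fun a _ => Setoid.refl' _ a, fun h i => Setoid.symm' _ (h i),
        fun h h' i => Setoid.trans' _ (h i) (h' i)⟩ }
  have hθ : θ ≤ M.leibniz := by
    refine le_leibniz (fun n g x y hxy i => ?_) fun a b hab ha => ?_
    · exact (M.withFilter (coordFilter M f i)).isCongruence_leibniz n g x y fun k => hxy k i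
    · exact mem_filter_of_mem_coordFilter (f := f) hM fun i =>
        (M.withFilter (coordFilter M f i)).isCompatible_leibniz a b (hab i)
          (filter_subset_coordFilter hM hf i ha)
  exact hθ h

/-- The `i`-th coordinate filter satisfies every rule whose `i`-th component is valid in the
Suszko-reduced models of the `i`-th logic, because the model satisfies the rule
`y, {dᵢ(γ, y) : γ ∈ Γ} ⊢ dᵢ(φ, y)`. -/
theorem coordFilter_rule (hM : (tensorLogic P).IsModel M) (hf : f ∈ M.filter) (i : I)
    {X : Type u} (hX : #X ≤ tensorCard P)
    (Γ : Set ((tensorLang fun i => (P i).lang).Term X))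
    (φ : (tensorLang fun i => (P i).lang).Term X)
    (hval : ∀ C ∈ (P i).suszkoModels, ∀ v : X → C.carrier,
      (∀ γ ∈ Γ, (component i γ).realize v ∈ C.filter) → (component i φ).realize v ∈ C.filter)
    (v : X → M.carrier) (hv : ∀ γ ∈ Γ, γ.realize v ∈ coordFilter M f i) :
    φ.realize v ∈ coordFilter M f i := by
  let d : (tensorLang fun i => (P i).lang).Term X →
      (tensorLang fun i => (P i).lang).Term (Option X) := fun t =>
    decompTerm i (t.subst fun x => Term.var (some x)) (Term.var none)
  have hd : ∀ t, (d t).realize (fun o => o.elim f v) = decomp M i (t.realize v) f := by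
    intro t
    rw [realize_decompTerm, Term.realize_subst]
    rfl
  have hdi : ∀ t, component i (d t) = (component i t).subst fun x => Term.var (some x) := by
    intro t
    rw [component_decompTerm_self, component_subst]
    rfl
  change decomp M i (φ.realize v) f ∈ M.filter
  rw [← hd]
  refine tensorLogic_rule hM (mk_option_le_tensorCard hX) (insert (Term.var none) (d '' Γ)) (d φ)
    ?_ _ ?_
  · intro N hN w hw j
    have hy := hw _ (Set.mem_insert _ _) j
    by_cases hj : j = i
    · subst hj
      rw [hdi, Term.realize_subst]
      refine hval (N j) (hN j) _ fun γ hγ => ?_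
      have := hw _ (Set.mem_insert_of_mem _ ⟨γ, hγ, rfl⟩) j
      rwa [hdi, Term.realize_subst] at this
    · rwa [component_decompTerm_of_ne hj]
  · rintro _ (rfl | ⟨γ, hγ, rfl⟩)
    · exact hf
    · rw [hd]
      exact hv γ hγ

/-- Membership in the `i`-th coordinate filter of the value of a term depends on the `i`-th
component of the term only. A bound on the number of parameters is not needed, because terms are finite. -/
theorem coordFilter_congr (hM : (tensorLogic P).IsModel M) (hf : f ∈ M.filter) (i : I)
    {p q : (tensorLang fun i => (P i).lang).Term M.carrier} (hpq : component i p = component i q)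
    (hp : p.realize id ∈ coordFilter M f i) : q.realize id ∈ coordFilter M f i := by
  classical
  have hinf : Infinite (tensorCard P).ord.ToType := by
    rw [Cardinal.infinite_iff, mk_ord_toType]
    exact aleph0_le_tensorCard P
  obtain ⟨g, w, hgw⟩ := exists_leftInvOn_finset (X := (tensorCard P).ord.ToType)
    (p.varFinset ∪ q.varFinset)
  have hr : ∀ t : (tensorLang fun i => (P i).lang).Term M.carrier,
      t.varFinset ⊆ p.varFinset ∪ q.varFinset →
        (t.subst fun a => Term.var (g a)).realize w = t.realize id := by
    intro t ht
    rw [Term.realize_subst]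
    exact realize_congr_varFinset t fun a ha => hgw a (ht ha)
  rw [← hr q Finset.subset_union_right]
  rw [← hr p Finset.subset_union_left] at hp
  refine coordFilter_rule hM hf i (mk_ord_toType _).le {p.subst fun a => Term.var (g a)} _ ?_ w ?_
  · intro C _ v hv
    rw [component_subst, ← hpq, ← component_subst]
    exact hv _ rfl
  · rintro _ rfl
    exact hp

theorem dependsOnlyOn_reduction_coordFilter (hM : (tensorLogic P).IsModel M) (hf : f ∈ M.filter)
    (i : I) : DependsOnlyOn i (M.withFilter (coordFilter M f i)).reduction := by
  intro s t hst
  let D := M.withFilter (coordFilter M f i)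
  let σ : D.reduction.carrier → M.carrier := Function.surjInv D.toReduction_surjective
  have hσ : D.toReduction ∘ σ = id := funext (Function.surjInv_eq D.toReduction_surjective)
  change s.realize id = t.realize id
  rw [← hσ, HomClass.realize_term, HomClass.realize_term, toReduction_eq_iff]
  refine D.leibniz_of_polynomials fun p => ?_
  let τ : (tensorLang fun i => (P i).lang).Term D.reduction.carrier → Option M.carrier →
      (tensorLang fun i => (P i).lang).Term M.carrier :=
    fun s o => o.elim (s.subst fun c => Term.var (σ c)) Term.var
  have hτ : ∀ s, (p.subst (τ s)).realize id =
      p.realize fun o => o.elim (s.realize (M := M.carrier) σ) id := by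
    intro s
    rw [Term.realize_subst]
    congr 1
    funext o
    cases o with
    | some a => rfl
    | none => exact Term.realize_subst
  have hc : component i (p.subst (τ s)) = component i (p.subst (τ t)) := by
    rw [component_subst, component_subst]
    congr 1
    funext o
    cases o with
    | some a => rfl
    | none =>
      simp only [τ, Option.elim_none]
      rw [component_subst, component_subst, hst]
  have h₁ := coordFilter_congr hM hf i hc
  have h₂ := coordFilter_congr hM hf i hc.symm
  rw [hτ, hτ] at h₁ h₂
  exact ⟨h₁, h₂⟩

/-- The reduction of a model of `⨂ᵢ ⊢ᵢ` with respect to its `i`-th coordinate filter is the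
inflation of a Leibniz-reduced model of the `i`-th logic. -/
theorem restrict_coordFilter_mem (hM : (tensorLogic P).IsModel M) (hf : f ∈ M.filter) (i : I) :
    restrict (P i).noConst (M.withFilter (coordFilter M f i)).reduction ∈
      reducedClass (P i).models := by
  let D := M.withFilter (coordFilter M f i)
  refine PropLogic.mem_reducedClass_models.2 ⟨?_,
    (dependsOnlyOn_reduction_coordFilter hM hf i).leibniz_restrict _ D.leibniz_reduction⟩
  intro Γ φ hΓ v hv
  obtain ⟨w, rfl⟩ : ∃ w : (P i).Var → M.carrier, D.toReduction ∘ w = v :=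
    ⟨fun x => Function.surjInv D.toReduction_surjective (v x),
      funext fun x => Function.surjInv_eq D.toReduction_surjective _⟩
  have key : ∀ t : (P i).Fm,
      Term.realize (M := (restrict (P i).noConst D.reduction).carrier) (D.toReduction ∘ w) t ∈
        (restrict (P i).noConst D.reduction).filter ↔
      (liftTerm (L := fun i => (P i).lang) (P i).noConst t).realize w ∈ coordFilter M f i := by
    intro t
    have h := (realize_restrict (L := fun i => (P i).lang) (P i).noConst D.reduction t
      (D.toReduction ∘ w)).trans (HomClass.realize_term D.toReduction)
    exact (iff_of_eq (congrArg (· ∈ D.reduction.filter) h)).trans (D.toReduction_mem_iff _).symm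
  refine (key φ).2 ?_
  refine coordFilter_rule hM hf i ((mk_ord_toType _).le.trans (card_le_tensorCard P i))
    (liftTerm (L := fun i => (P i).lang) (P i).noConst '' Γ) _ ?_ w ?_
  · intro C hC u hu
    rw [component_liftTerm]
    refine hC.1 Γ φ hΓ u fun γ hγ => ?_
    have := hu _ ⟨γ, hγ, rfl⟩
    rwa [component_liftTerm] at this
  · rintro _ ⟨γ, hγ, rfl⟩
    exact (key γ).1 (hv γ hγ)

/-- The homomorphism of a model onto its reduction with respect to the `i`-th coordinate filter. -/
def coordHom (hM : (tensorLogic P).IsModel M) (hf : f ∈ M.filter) (i : I) :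
    M.carrier →[tensorLang fun i => (P i).lang]
      (inflate i (restrict (P i).noConst
        (M.withFilter (coordFilter M f i)).reduction)).carrier :=
  ((dependsOnlyOn_reduction_coordFilter hM hf i).toInflate (P i).noConst).comp
    (M.withFilter (coordFilter M f i)).toReduction

theorem isOnto_coordHom (hM : (tensorLogic P).IsModel M) (hf : f ∈ M.filter) (i : I) :
    IsOnto (coordHom hM hf i) :=
  ⟨(M.withFilter (coordFilter M f i)).toReduction_surjective, fun a ha =>
    ((M.withFilter (coordFilter M f i)).toReduction_mem_iff a).1
      (filter_subset_coordFilter hM hf i ha)⟩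

end CoordFilter

/-! ### Subdirect representations -/

/-- Suszko-reduced models of `⨂ᵢ ⊢ᵢ` are subdirect products of non-indexed products of
Leibniz-reduced models; all factors but one of these products may be taken trivial. -/
theorem suszkoModels_tensorLogic_subset :
    (tensorLogic P).suszkoModels ⊆
      subdirectProducts (tensorClass fun i => reducedClass (P i).models) := by
  intro (M : LMatrix (tensorLang fun i => (P i).lang)) hM
  obtain ⟨hMod, hsep⟩ := PropLogic.mem_suszkoModels_iff.1 hM
  have hmem : ∀ {i : I} {C : LMatrix (P i).lang}, C ∈ reducedClass (P i).models →
      inflate (L := fun i => (P i).lang) i C ∈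
        tensorClass fun i => reducedClass (P i).models := fun hC =>
    inflate_mem_tensorClass (fun i => pointMatrix_univ_mem_reducedClass (P i)) hC
  refine mem_subdirectProducts_of_separated (L := tensorLang fun i => (P i).lang)
    (fun a b hab => ?_) fun a ha => ?_
  · obtain ⟨(N : LMatrix (tensorLang fun i => (P i).lang)), hN,
      (h : M.carrier →[tensorLang fun i => (P i).lang] N.carrier), hh, hne⟩ := hsep a b hab
    obtain ⟨hNm, hNl⟩ := PropLogic.mem_reducedClass_models.1 hN
    have hnot : ¬ N.leibniz (h a) (h b) := fun hl => hne (hNl.le hl)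
    obtain ⟨f, hf⟩ : N.filter.Nonempty := by
      rw [Set.nonempty_iff_ne_empty]
      exact fun h0 => hnot (leibniz_of_filter_eq_empty h0 _ _)
    obtain ⟨i, hi⟩ : ∃ i, ¬ (N.withFilter (coordFilter N f i)).leibniz (h a) (h b) := by
      by_contra! hall
      exact hnot (leibniz_of_leibniz_coordFilter hNm hf hall)
    refine ⟨_, hmem (restrict_coordFilter_mem hNm hf i), (coordHom hNm hf i).comp h,
      (isOnto_coordHom hNm hf i).comp hh, fun he => hi ?_⟩
    exact (toReduction_eq_iff _).1 he
  · by_cases hF : M.filter.Nonempty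
    · obtain ⟨f, hf⟩ := hF
      obtain ⟨i, hi⟩ : ∃ i, a ∉ coordFilter M f i := by
        by_contra! hall
        exact ha (mem_filter_of_mem_coordFilter hMod hall)
      refine ⟨_, hmem (restrict_coordFilter_mem hMod hf i), coordHom hMod hf i,
        isOnto_coordHom hMod hf i, fun he => hi ?_⟩
      exact (toReduction_mem_iff (M.withFilter (coordFilter M f i)) a).2 he
    · -- Some factor has no theorems, so that `⟨1, ∅⟩` is one of its reduced models.
      obtain ⟨i, hi⟩ : ∃ i, ∀ φ, ¬ (P i).Entails ∅ φ := by
        by_contra! hall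
        exact hF (filter_nonempty_of_theorems hMod hall)
      refine ⟨_, hmem (pointMatrix_empty_mem_reducedClass hi),
        homOfFun (L := tensorLang fun i => (P i).lang)
          (N := inflate (L := fun i => (P i).lang) i (pointMatrix (P i).lang ∅))
          (fun _ => PUnit.unit) fun _ _ _ => rfl, ⟨?_, ?_⟩, fun h => h⟩
      · exact fun _ => ⟨a, rfl⟩
      · exact fun b hb => (hF ⟨b, hb⟩).elim

/-- For a subdirect product of non-indexed products, the images of the coordinate maps are subdirect
products of the factors, and they provide a non-indexed subdirect representation. -/
theorem exists_isNonIndexedSubdirect {M : LMatrix (tensorLang fun i => (P i).lang)}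
    (hM : M ∈ subdirectProducts (tensorClass fun i => (P i).suszkoModels)) :
    ∃ N : ∀ i, LMatrix (P i).lang, (∀ i, N i ∈ (P i).suszkoModels) ∧
      IsNonIndexedSubdirect M N := by
  obtain ⟨J, N, hN, e, he, hs⟩ := hM
  have hT : ∀ j, ∃ T : ∀ i, LMatrix (P i).lang, (∀ i, T i ∈ (P i).suszkoModels) ∧
      (N j).Iso (tensorMatrix T) := by
    intro j
    obtain ⟨_, ⟨T, hT, rfl⟩, hiso⟩ := hN j
    exact ⟨T, hT, hiso⟩
  choose T hT ε hε using hT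
  let g : ∀ j i, M.carrier →[tensorLang fun i => (P i).lang]
      (inflate (L := fun i => (P i).lang) i (T j i)).carrier := fun j i =>
    (tensorProjHom (T j) i).comp ((ε j).toHom.comp ((prodProj N j).comp e.toHom))
  have hgs : ∀ j i, Function.Surjective (g j i) := by
    intro j i
    exact (tensorProj_surjective (T j) i).comp ((ε j).surjective.comp (hs j))
  -- The image of `M` in the product of the `i`-th factors.
  let S : ∀ i, (P i).lang.Substructure (LMatrix.prod fun j => T j i).carrier := fun i =>
    { carrier := Set.range fun m j => g j i m
      fun_mem := by
        intro n f x hx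
        choose m hm using hx
        refine ⟨Structure.funMap (liftSymbol (L := fun i => (P i).lang) (P i).noConst f) m,
          funext fun j => ?_⟩
        refine ((g j i).map_fun _ _).trans ?_
        refine (funMap_liftSymbol_inflate (L := fun i => (P i).lang) (P i).noConst _ _ _).trans ?_
        exact congrArg (Structure.funMap (M := (T j i).carrier) f)
          (funext fun k => congrFun (hm k) j) }
  let A : ∀ i, LMatrix (P i).lang := fun i =>
    { carrier := S i
      nonempty := ⟨⟨_, Classical.arbitrary M.carrier, rfl⟩⟩
      filter := {c | c.1 ∈ (LMatrix.prod fun j => T j i).filter} }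
  have hA : ∀ i, A i ∈ (P i).suszkoModels := by
    intro i
    refine subdirectProducts_suszkoModels_subset (P i)
      ⟨J, fun j => T j i, fun j => hT j i, (S i).subtype, fun _ => Iff.rfl, fun j c => ?_⟩
    obtain ⟨m, hm⟩ := hgs j i c
    exact ⟨⟨_, m, rfl⟩, hm⟩
  have hreal : ∀ i j {n : ℕ} (t : (P i).lang.Term (Fin n)) (v : Fin n → S i),
      Term.realize (M := (T j i).carrier) (fun l => prodProj (fun j => T j i) j (v l).1) t =
        prodProj (fun j => T j i) j (t.realize v).1 := fun i j _ t v =>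
    HomClass.realize_term ((prodProj (fun j => T j i) j).comp (S i).subtype.toHom)
  let k : M.carrier →[tensorLang fun i => (P i).lang] (tensorMatrix A).carrier :=
    homOfFun (N := tensorMatrix A) (fun m i => ⟨fun j => g j i m, m, rfl⟩) fun n φ x =>
      funext fun i => Subtype.ext <| funext fun j =>
        ((g j i).map_fun φ x).trans <|
          hreal i j (φ.1 i) fun l => ⟨fun j => g j i (x l), x l, rfl⟩
  have hk : Function.Injective k := by
    intro a b hab
    refine e.injective (funext fun j => (ε j).injective (funext fun i => ?_))
    exact congrFun (congrArg Subtype.val (congrFun hab i)) j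
  refine ⟨A, hA, Embedding.ofInjective hk, fun a => ?_, ?_⟩
  · rw [he]
    exact ⟨fun h i j => (hε j _).1 (h j) i, fun h j => (hε j _).2 fun i => h i j⟩
  · rintro i ⟨_, m, rfl⟩
    exact ⟨m, rfl⟩

/-- Non-indexed subdirect products of Suszko-reduced models are Suszko-reduced. -/
theorem IsNonIndexedSubdirect.mem_suszkoModels {M : LMatrix (tensorLang fun i => (P i).lang)}
    {N : ∀ i, LMatrix (P i).lang} (hN : ∀ i, N i ∈ (P i).suszkoModels)
    (h : IsNonIndexedSubdirect M N) : M ∈ (tensorLogic P).suszkoModels := by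
  obtain ⟨e, he, hs⟩ := h
  have hinf : ∀ {i : I} {C : LMatrix (P i).lang}, C ∈ reducedClass (P i).models →
      (inflate (L := fun i => (P i).lang) i C) ∈ reducedClass (tensorLogic P).models := by
    intro i C hC
    refine PropLogic.mem_reducedClass_models.2 ⟨tensorLogic_isModel_of_mem ?_,
      leibniz_inflate (P i).noConst (PropLogic.mem_reducedClass_models.1 hC).2⟩
    exact inflate_mem_tensorClass (fun j => PropLogic.reducedClass_models_subset_suszkoModels
      (pointMatrix_univ_mem_reducedClass (P j)))
      (PropLogic.reducedClass_models_subset_suszkoModels hC)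
  have hT : (tensorLogic P).IsModel (tensorMatrix N) :=
    tensorLogic_isModel_of_mem ⟨_, ⟨N, hN, rfl⟩, Language.Equiv.refl _ _, fun _ => Iff.rfl⟩
  refine PropLogic.mem_suszkoModels_iff.2 ⟨hT.of_strict e.toHom he, fun a b hab => ?_⟩
  obtain ⟨i, hi⟩ : ∃ i, tensorProj N i (e a) ≠ tensorProj N i (e b) := by
    by_contra! hall
    exact hab (e.injective (funext hall))
  obtain ⟨C, hC, g, hg, hne⟩ := (PropLogic.mem_suszkoModels_iff.1 (hN i)).2 _ _ hi
  exact ⟨_, hinf hC, ((inflateHom (L := fun i => (P i).lang) g).comp (tensorProjHom N i)).comp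
      e.toHom,
    ⟨hg.1.comp (hs i), fun a ha => hg.2 _ ((he a).1 ha i)⟩, hne⟩

theorem isNonIndexedSubdirect_of_iso {L : I → FirstOrder.Language.{u, u}}
    {M : LMatrix (tensorLang L)} {N : ∀ i, LMatrix (L i)} (h : M.Iso (tensorMatrix N)) :
    IsNonIndexedSubdirect M N := by
  obtain ⟨e, he⟩ := h
  exact ⟨e.toEmbedding, he, fun i => (tensorProj_surjective N i).comp e.surjective⟩

/-- With two factors, the operation `dᵢ`, for either index `i`, makes every non-indexed
subdirect product the whole non-indexed product. -/
theorem iso_of_isNonIndexedSubdirect_pair {P Q : PropLogic.{u}}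
    {M : LMatrix (tensorLang fun b => (pair P Q b).lang)}
    {N : ∀ b, LMatrix (pair P Q b).lang} (h : IsNonIndexedSubdirect M N) :
    M.Iso (tensorMatrix N) := by
  obtain ⟨e, he, hs⟩ := h
  refine iso_of_bijective e.toHom ⟨e.injective, fun c => ?_⟩ he
  obtain ⟨a, ha⟩ := hs ⟨false⟩ (tensorProj N ⟨false⟩ c)
  obtain ⟨b, hb⟩ := hs ⟨true⟩ (tensorProj N ⟨true⟩ c)
  refine ⟨decomp M ⟨false⟩ a b, funext fun i => ?_⟩
  let v : Fin 2 → M.carrier := ![a, b]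
  let t : (tensorLang fun b => (pair P Q b).lang).Term (Fin 2) :=
    decompTerm ⟨false⟩ (Term.var 0) (Term.var 1)
  have ht : t.realize v = decomp M ⟨false⟩ a b := realize_decompTerm _ _ _ _ _
  have key : ∀ i, tensorProj N i (e (decomp M ⟨false⟩ a b)) =
      (component i t).realize fun x => tensorProj N i (e (v x)) := by
    intro i
    rw [← ht, ← HomClass.realize_term, tensorProj_realize]
    rfl
  refine (key i).trans ?_
  obtain ⟨_ | _⟩ := i
  · rw [component_decompTerm_self]
    exact ha
  · rw [component_decompTerm_of_ne (by simp)]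
    exact hb

end

end AAL

theorem mainTheorem2 :
    (∀ (I : Type u) (P : I → AAL.PropLogic.{u}),
      (AAL.tensorLogic P).suszkoModels =
          AAL.subdirectProducts (AAL.tensorClass fun i => AAL.reducedClass (P i).models) ∧
      (AAL.tensorLogic P).suszkoModels =
          AAL.subdirectProducts (AAL.tensorClass fun i => (P i).suszkoModels) ∧
      (AAL.tensorLogic P).suszkoModels =
          {M | ∃ N : ∀ i, AAL.LMatrix (P i).lang, (∀ i, N i ∈ (P i).suszkoModels) ∧
            AAL.IsNonIndexedSubdirect M N}) ∧
    (∀ P Q : AAL.PropLogic.{u},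
      (AAL.tensorLogic (AAL.pair P Q)).suszkoModels =
        AAL.tensorClass fun b => (AAL.pair P Q b).suszkoModels) := by
  have h₁ : ∀ (I : Type u) (P : I → AAL.PropLogic.{u}), (AAL.tensorLogic P).suszkoModels ⊆
      AAL.subdirectProducts (AAL.tensorClass fun i => AAL.reducedClass (P i).models) :=
    fun I P => AAL.suszkoModels_tensorLogic_subset
  have h₂ : ∀ (I : Type u) (P : I → AAL.PropLogic.{u}),
      AAL.subdirectProducts (AAL.tensorClass fun i => AAL.reducedClass (P i).models) ⊆
        AAL.subdirectProducts (AAL.tensorClass fun i => (P i).suszkoModels) := by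
    refine fun I P => AAL.subdirectProducts_mono ?_
    rintro M ⟨_, ⟨N, hN, rfl⟩, hM⟩
    exact ⟨_, ⟨N, fun i => AAL.PropLogic.reducedClass_models_subset_suszkoModels (hN i), rfl⟩, hM⟩
  have h₃ : ∀ (I : Type u) (P : I → AAL.PropLogic.{u}),
      AAL.subdirectProducts (AAL.tensorClass fun i => (P i).suszkoModels) ⊆
        {M | ∃ N : ∀ i, AAL.LMatrix (P i).lang, (∀ i, N i ∈ (P i).suszkoModels) ∧
          AAL.IsNonIndexedSubdirect M N} :=
    fun I P M hM => AAL.exists_isNonIndexedSubdirect hM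
  have h₄ : ∀ (I : Type u) (P : I → AAL.PropLogic.{u}),
      {M | ∃ N : ∀ i, AAL.LMatrix (P i).lang, (∀ i, N i ∈ (P i).suszkoModels) ∧
        AAL.IsNonIndexedSubdirect M N} ⊆ (AAL.tensorLogic P).suszkoModels := by
    rintro I P M ⟨N, hN, h⟩
    exact h.mem_suszkoModels hN
  refine ⟨fun I P => ⟨?_, ?_, ?_⟩, fun P Q => ?_⟩
  · exact (h₁ I P).antisymm ((h₂ I P).trans ((h₃ I P).trans (h₄ I P)))
  · exact ((h₁ I P).trans (h₂ I P)).antisymm ((h₃ I P).trans (h₄ I P))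
  · exact ((h₁ I P).trans ((h₂ I P).trans (h₃ I P))).antisymm (h₄ I P)
  · refine Set.Subset.antisymm (fun M hM => ?_) ?_
    · obtain ⟨N, hN, h⟩ := h₃ _ _ (h₂ _ _ (h₁ _ _ hM))
      exact ⟨_, ⟨N, hN, rfl⟩, AAL.iso_of_isNonIndexedSubdirect_pair h⟩
    · rintro M ⟨_, ⟨N, hN, rfl⟩, hM⟩
      exact h₄ _ _ ⟨N, hN, AAL.isNonIndexedSubdirect_of_iso hM⟩
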